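/- **Theorem (secrecy capacity in the bandwidth-limited regime).** *Model.* A distributed storage system $\mathcal D(n,k)$ with repair degree $d$ has $n$ active storage nodes at every time. A file $S$, uniformly distributed over $\mathbb F_q^R$ for a finite field $\mathbb F_q$, is encoded by a (randomized) source into the contents of the $n$ initial nodes; each node stores at most $\alpha$ data units. Nodes fail one at a time, in any order. A failed node is immediately replaced by a new one, which connects to $d$ other active nodes (any $d$ of them) and downloads from each of them at most $\beta$ units, computed from what that node stores; $\gamma=d\beta$ is the repair bandwidth. The new node stores a function of what it downloads. Let $C_i$ be the content of node $i$ and $D_i$ the data revealed to an eavesdropper who accesses node $i$: everything node $i$ downloads if it is a replacement node, and $D_i=C_i$ if it is one of the initial nodes. A data unit consists of a fixed number $m\ge 1$ of symbols of $\mathbb F_q$ (for $m=1$ a unit is a symbol); the entropy $H$ is measured in data units, so $H(S)=R/m$. The numbers of symbols stored and downloaded per link are integers. The secrecy capacity $C_s(\alpha,\gamma)$ is the supremum of $H(S)$ over all such schemes with, for all sequences of failures and repairs, $H(S\mid C_B)=0$ for every set $B$ of $k$ simultaneously active nodes (reconstruction), and $H(S\mid D_E)=H(S)$ for every set $E$ of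 at most $\ell$ nodes among all nodes that ever exist (perfect secrecy). The field $\mathbb F_q$ and the number $m$ of symbols per unit are free to choose; let $C_s^{q,m}$ be the same supremum for fixed $\mathbb F_q$ and $m$. For $\Gamma\ge 0$ put $$C_s^{BL}(\Gamma)=\sup_{0\le\gamma\le\Gamma,\ \alpha\ge 0} C_s(\alpha,\gamma),$$ and define $C_s^{BL,q,m}(\Gamma)$ in the same way from $C_s^{q,m}$. *Statement.* Let $0\le\ell<k\le n-1$, $d=n-1$, and $\Gamma\ge 0$ real. Then $$C_s^{BL}(\Gamma)=\sum_{i=\ell+1}^{k}(n-i)\,\frac{\Gamma}{n-1},$$ and this value is achieved with node storage $\alpha=\Gamma$: $C_s(\Gamma,\Gamma)=C_s^{BL}(\Gamma)$. Moreover, if $m\Gamma/(n-1)=b$ is an integer (for instance $m=1$ and $\Gamma=(n-1)b$), then over every finite field with $q\ge n(n-1)/2$ one has $C_s^{BL,q,m}(\Gamma)=C_s^{q,m}(\Gamma,\Gamma)=\sum_{i=\ell+1}^{k}(n-i)\frac{\Gamma}{n-1}$, and the supremum is attained: there is a scheme with perfect secrecy and the reconstruction property in which each node stores $(n-1)b=m\Gamma$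 symbols, each repair downloads $b$ symbols from each of the other $n-1$ active nodes, and the file has $\sum_{i=\ell+1}^{k}(n-i)b$ symbols. -/

import Mathlib

noncomputable section

/-! ### Shannon entropy of finite random variables -/

/-- Shannon entropy `H(X)`, in base `q`, of a finitely valued random variable `X` on a
probability space with law `p`. -/
def shannonEntropy (q : ℝ) {Ω A : Type*} [Fintype A] (p : PMF Ω) (X : Ω → A) : ℝ :=
  (∑ x, Real.negMulLog ((p.map X) x).toReal) / Real.log q

/-- Conditional entropy `H(X | Y) = - ∑ P(x, y) log_q (P(x, y) / P(y))`.  Terms with `P(x, y) = 0`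
(in particular those with `P(y) = 0`) are zero. -/
def shannonCondEntropy (q : ℝ) {Ω A B : Type*} [Fintype A] [Fintype B] (p : PMF Ω)
    (X : Ω → A) (Y : Ω → B) : ℝ :=
  (∑ y, ∑ x, -(((p.map fun ω => (X ω, Y ω)) (x, y)).toReal *
    Real.log (((p.map fun ω => (X ω, Y ω)) (x, y)).toReal / ((p.map Y) y).toReal))) / Real.log q

/-! ### Distributed storage systems under failures and repairs -/

/-- One failure with its repair.  The `n` active nodes occupy the slots `Fin n`; the node in slot
`failed` is replaced by a new node, which connects to the `d` active nodes in `helpers`. -/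
structure RepairEvent (n d : ℕ) where
  failed : Fin n
  helpers : Finset (Fin n)
  card_helpers : helpers.card = d
  failed_notMem : failed ∉ helpers

/-- The first `t` events of a failure pattern, in chronological order. -/
def pastEvents {n d : ℕ} (σ : ℕ → RepairEvent n d) (t : ℕ) : List (RepairEvent n d) :=
  (List.range t).map σ

/-- A storage and repair scheme over the alphabet `F` with repair degree `d`: the file has `R`
symbols, each node stores `a` symbols, a new node downloads `b` symbols from each of its `d`
helpers.  All coding functions are arbitrary, and may depend on the failures and repairs so far.

* `encode`: the (randomized) encoder of the source, from the file to the initial contents;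
* `send h e j`: the message sent for the repair `e`, after the past events `h`, by the node in
  slot `j`, as a function of what this node stores;
* `regenerate h e`: what the new node stores, as a function of what it downloads (a tuple indexed
  by all slots, with `0` at slots that are not contacted). -/
structure StorageScheme (F : Type) (n d a b R : ℕ) where
  encode : (Fin R → F) → PMF (Fin n → Fin a → F)
  send : List (RepairEvent n d) → RepairEvent n d → Fin n → (Fin a → F) → (Fin b → F)
  regenerate : List (RepairEvent n d) → RepairEvent n d → (Fin n → Fin b → F) → (Fin a → F)

namespace StorageScheme

variable {F : Type} [Field F] [Fintype F] {n d a b R : ℕ}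

/-- Joint law of the file `S`, uniform on `F ^ R`, and of the initial contents of the nodes. -/
def law (sch : StorageScheme F n d a b R) : PMF ((Fin R → F) × (Fin n → Fin a → F)) :=
  (PMF.uniformOfFintype (Fin R → F)).bind fun s => (sch.encode s).map fun c => (s, c)

/-- What the new node downloads in the repair `σ t`, if the slots have contents `c` before it. -/
def download (sch : StorageScheme F n d a b R) (σ : ℕ → RepairEvent n d) (t : ℕ)
    (c : Fin n → Fin a → F) : Fin n → Fin b → F :=
  open Classical in fun j =>
    if j ∈ (σ t).helpers then sch.send (pastEvents σ t) (σ t) j (c j) else 0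

/-- The contents of the active nodes after the first `t` failures and repairs of the failure
pattern `σ`, as a function of the outcome of the source. -/
def stored (sch : StorageScheme F n d a b R) (σ : ℕ → RepairEvent n d) :
    ℕ → (Fin R → F) × (Fin n → Fin a → F) → Fin n → Fin a → F
  | 0, ω => ω.2
  | t + 1, ω => Function.update (stored sch σ t ω) (σ t).failed
      (sch.regenerate (pastEvents σ t) (σ t) (sch.download σ t (stored sch σ t ω)))

/-- The data revealed to an eavesdropper who accesses a node.  The nodes are the initial ones,
`Sum.inl i`, which receive their contents from the source, and the replacement nodes `Sum.inr t`
(the one added in the repair `σ t`), which reveal everything they download. -/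
def revealed (sch : StorageScheme F n d a b R) (σ : ℕ → RepairEvent n d)
    (ω : (Fin R → F) × (Fin n → Fin a → F)) :
    Fin n ⊕ ℕ → (Fin a → F) ⊕ (Fin n → Fin b → F)
  | Sum.inl i => Sum.inl (ω.2 i)
  | Sum.inr t => Sum.inr (sch.download σ t (sch.stored σ t ω))

/-- `H(S)`, in symbols of `F`. -/
def fileEntropy (sch : StorageScheme F n d a b R) : ℝ :=
  shannonEntropy (Fintype.card F) sch.law Prod.fst

/-- Reconstruction property: `H(S | C_B) = 0` for every set `B` of `k` nodes that are active at
the same time, whatever the failures and repairs. -/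
def Reconstructs (sch : StorageScheme F n d a b R) (k : ℕ) : Prop :=
  ∀ (σ : ℕ → RepairEvent n d) (t : ℕ) (B : Finset (Fin n)), B.card = k →
    shannonCondEntropy (Fintype.card F) sch.law Prod.fst
      (fun ω (i : {i // i ∈ B}) => sch.stored σ t ω i) = 0

/-- Perfect secrecy: `H(S | D_E) = H(S)` for every set `E` of at most `ℓ` nodes among all nodes
that ever exist, whatever the failures and repairs. -/
def Secure (sch : StorageScheme F n d a b R) (ℓ : ℕ) : Prop :=
  ∀ (σ : ℕ → RepairEvent n d) (E : Finset (Fin n ⊕ ℕ)), E.card ≤ ℓ →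
    shannonCondEntropy (Fintype.card F) sch.law Prod.fst
      (fun ω (v : {v // v ∈ E}) => sch.revealed σ ω v) = sch.fileEntropy

end StorageScheme

/-! ### Secrecy capacity

The parameters are the number `n` of active nodes, the number `k` of nodes contacted by a data
collector, the repair degree `d`, and the number `ℓ` of compromised nodes.  The node storage `α`
and the repair bandwidth `γ` are measured in data units. -/

/-- Secrecy capacity `C_s(α, γ)` when a data unit consists of `m` symbols of the field `F`: the
supremum of `H(S)`, in data units, over all schemes with the reconstruction property and perfect
secrecy whose nodes store at most `α` units and download at most `γ / d` units from each of the
`d` helpers.  For `m = 1` a unit is a symbol of `F`. -/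
def secrecyCapacityOver (F : Type) [Field F] [Fintype F] (m n k d ℓ : ℕ) (α γ : ℝ) : EReal :=
  ⨆ (a : ℕ) (b : ℕ) (R : ℕ) (sch : StorageScheme F n d a b R)
    (_ : (a : ℝ) ≤ m * α ∧ (d : ℝ) * b ≤ m * γ ∧ sch.Reconstructs k ∧ sch.Secure ℓ),
    ((sch.fileEntropy / m : ℝ) : EReal)

/-- Secrecy capacity `C_s(α, γ)`, with the finite field and the number of its symbols per data unit
free to choose. -/
def secrecyCapacity (n k d ℓ : ℕ) (α γ : ℝ) : EReal :=
  ⨆ (F : Type) (_ : Field F) (_ : Fintype F) (m : ℕ) (_ : 0 < m),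
    secrecyCapacityOver F m n k d ℓ α γ

/-- Secrecy capacity in the bandwidth-limited regime: `γ ≤ Γ`, with no bound on `α`; the data unit
consists of `m` symbols of `F`. -/
def bandwidthLimitedCapacityOver (F : Type) [Field F] [Fintype F] (m n k d ℓ : ℕ) (Γ : ℝ) :
    EReal :=
  ⨆ (γ : ℝ) (_ : 0 ≤ γ ∧ γ ≤ Γ) (α : ℝ) (_ : 0 ≤ α), secrecyCapacityOver F m n k d ℓ α γ

/-- Secrecy capacity `C_s^{BL}(Γ)` in the bandwidth-limited regime. -/
def bandwidthLimitedCapacity (n k d ℓ : ℕ) (Γ : ℝ) : EReal :=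
  ⨆ (γ : ℝ) (_ : 0 ≤ γ ∧ γ ≤ Γ) (α : ℝ) (_ : 0 ≤ α), secrecyCapacity n k d ℓ α γ

end

/-!
The stored file is uniform, so its entropy is its size. Reconstruction means that the contents of
`k` active nodes never agree for two different files, and perfect secrecy means that the conditional
law of the eavesdropped data given the file does not depend on the file.

Converse: let `d + 1` slots fail in succession, each repaired from the others. The first `k`
replacement nodes determine the file, and by secrecy the first `ℓ` of them may be assumed to have
received the same data for all files. What an already repaired node sends is a function of earlier
downloads, so the `i`-th repair contributes only the messages of the `d + 1 - i` slots that have not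
failed yet. Hence a file is determined by `∑ (d + 1 - i)` messages of `b` symbols, where
`ℓ < i ≤ k`.

Achievability: label the edges of the complete graph on the `n` slots by the values, at distinct
points of the field, of `b` random polynomials whose low coefficients are keys and whose high
coefficients are file symbols. Both endpoints of an edge store its label, and a repair copies the
labels back, so nothing ever changes. A set of `c` nodes sees `∑ (n - i)` labels, where
`1 ≤ i ≤ c`: for `c = k` there are enough to interpolate the polynomials, and for `c = ℓ` there are
only as many as keys per polynomial, so they are independent of the file.
-/

section Entropy

variable {Ω A B : Type*} (p : PMF Ω) (X : Ω → A) (Y : Ω → B)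

/-- The probability `P(X = x)`, as a real number, for a random variable `X` on a probability space
with law `p`. -/
noncomputable def prob (x : A) : ℝ := ((p.map X) x).toReal

/-- The probability `P(X = x, Y = y)` in the form in which it enters `shannonCondEntropy`. -/
noncomputable def jointProb (x : A) (y : B) : ℝ := prob p (fun ω => (X ω, Y ω)) (x, y)

theorem prob_nonneg (x : A) : 0 ≤ prob p X x := ENNReal.toReal_nonneg

theorem jointProb_nonneg (x : A) (y : B) : 0 ≤ jointProb p X Y x y := prob_nonneg ..

theorem jointProb_pos_iff {x : A} {y : B} :
    0 < jointProb p X Y x y ↔ ∃ ω ∈ p.support, X ω = x ∧ Y ω = y := by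
  simp only [jointProb, prob, ENNReal.toReal_pos_iff, and_iff_left (PMF.apply_lt_top _ _),
    PMF.apply_pos_iff, PMF.mem_support_map_iff, Prod.mk.injEq]

theorem prob_le_prob_comp (f : A → B) (x : A) : prob p X x ≤ prob p (f ∘ X) (f x) := by
  refine ENNReal.toReal_mono (PMF.apply_ne_top _ _) ?_
  classical
  rw [← PMF.map_comp, PMF.map_apply f (p.map X)]
  exact (if_pos rfl).symm.trans_le
    (ENNReal.le_tsum (f := fun a => if f x = f a then (p.map X) a else 0) x)

theorem jointProb_le_prob_left (x : A) (y : B) : jointProb p X Y x y ≤ prob p X x :=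
  prob_le_prob_comp p _ Prod.fst (x, y)

theorem jointProb_le_prob_right (x : A) (y : B) : jointProb p X Y x y ≤ prob p Y y :=
  prob_le_prob_comp p _ Prod.snd (x, y)

theorem jointProb_comm (x : A) (y : B) : jointProb p X Y x y = jointProb p Y X y x :=
  le_antisymm (prob_le_prob_comp p _ Prod.swap (x, y)) (prob_le_prob_comp p _ Prod.swap (y, x))

theorem sum_prob [Fintype A] : ∑ x, prob p X x = 1 := by
  simp only [prob]
  rw [← ENNReal.toReal_sum fun x _ => PMF.apply_ne_top _ x,
    ← tsum_fintype (L := .unconditional _), PMF.tsum_coe, ENNReal.toReal_one]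

theorem sum_jointProb_left [Fintype A] (y : B) : ∑ x, jointProb p X Y x y = prob p Y y := by
  have marginal : p.map Y = (p.map fun ω => (X ω, Y ω)).map Prod.snd := by
    rw [PMF.map_comp]; rfl
  classical
  simp only [jointProb, prob, marginal]
  rw [← ENNReal.toReal_sum fun x _ => PMF.apply_ne_top _ _,
    PMF.map_apply Prod.snd (p.map fun ω => (X ω, Y ω)), ENNReal.tsum_prod']
  simp [tsum_fintype]

theorem sum_jointProb_right [Fintype B] (x : A) : ∑ y, jointProb p X Y x y = prob p X x := by
  simp only [jointProb_comm p X Y, sum_jointProb_left]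

theorem jointProb_eq_prob_right_iff [Finite A] (x : A) (y : B) :
    jointProb p X Y x y = prob p Y y ↔ ∀ x' ≠ x, jointProb p X Y x' y = 0 := by
  classical
  have := Fintype.ofFinite A
  rw [← sum_jointProb_left p X Y, ← Finset.add_sum_erase _ _ (Finset.mem_univ x), left_eq_add,
    Finset.sum_eq_zero_iff_of_nonneg fun x' _ => jointProb_nonneg p X Y x' y]
  simp

theorem neg_mul_log_div_nonneg {u v : ℝ} (hu : 0 ≤ u) (huv : u ≤ v) :
    0 ≤ -(u * Real.log (u / v)) :=
  neg_nonneg.2 <| mul_nonpos_of_nonneg_of_nonpos hu <|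
    Real.log_nonpos (div_nonneg hu (hu.trans huv)) (div_le_one_of_le₀ huv (hu.trans huv))

theorem neg_mul_log_div_eq_zero_iff {u v : ℝ} (hu : 0 ≤ u) (huv : u ≤ v) :
    -(u * Real.log (u / v)) = 0 ↔ u = 0 ∨ u = v := by
  rcases hu.eq_or_lt with rfl | hu
  · simp
  have hv := hu.trans_le huv
  rw [neg_eq_zero, mul_eq_zero, ← Real.log_one,
    Real.log_injOn_pos.eq_iff (div_pos hu hv) (Set.mem_Ioi.2 one_pos), div_eq_one_iff_eq hv.ne']

theorem sum_sum_eq_zero_iff_of_nonneg [Fintype A] [Fintype B] {f : A → B → ℝ}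
    (hf : ∀ x y, 0 ≤ f x y) : ∑ y, ∑ x, f x y = 0 ↔ ∀ x y, f x y = 0 := by
  simp only [Finset.sum_eq_zero_iff_of_nonneg fun y _ => Finset.sum_nonneg fun x _ => hf x y,
    Finset.sum_eq_zero_iff_of_nonneg fun x _ => hf x _, Finset.mem_univ, forall_const]
  exact forall_comm

variable [Fintype A] [Fintype B]

theorem shannonCondEntropy_eq_zero_iff {q : ℝ} (hq : 1 < q) :
    shannonCondEntropy q p X Y = 0 ↔
      ∀ ω ∈ p.support, ∀ ω' ∈ p.support, Y ω = Y ω' → X ω = X ω' := by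
  calc shannonCondEntropy q p X Y = 0
      ↔ ∑ y, ∑ x,
          -(jointProb p X Y x y * Real.log (jointProb p X Y x y / prob p Y y)) = 0 := by
        rw [shannonCondEntropy, div_eq_zero_iff, or_iff_left (Real.log_pos hq).ne']
        rfl
    _ ↔ ∀ x y, jointProb p X Y x y = 0 ∨ jointProb p X Y x y = prob p Y y := by
        rw [sum_sum_eq_zero_iff_of_nonneg fun x y =>
          neg_mul_log_div_nonneg (jointProb_nonneg ..) (jointProb_le_prob_right ..)]
        exact forall₂_congr fun x y =>
          neg_mul_log_div_eq_zero_iff (jointProb_nonneg ..) (jointProb_le_prob_right ..)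
    _ ↔ ∀ x y, 0 < jointProb p X Y x y → ∀ x', 0 < jointProb p X Y x' y → x' = x := by
        refine forall₂_congr fun x y => ?_
        simp only [jointProb_eq_prob_right_iff, (jointProb_nonneg p X Y _ _).lt_iff_ne']
        grind
    _ ↔ _ := by
        simp only [jointProb_pos_iff]
        constructor
        · intro h ω hω ω' hω' hY
          exact h _ _ ⟨ω', hω', rfl, rfl⟩ _ ⟨ω, hω, rfl, hY⟩
        · rintro h _ _ ⟨ω', hω', rfl, rfl⟩ _ ⟨ω, hω, rfl, hY⟩
          exact h ω hω ω' hω' hY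

/-- In units of `log q`, the left-hand side is the mutual information of `X` and `Y`, and the
right-hand side is the divergence of their joint law from the product of their laws. -/
theorem shannonEntropy_sub_shannonCondEntropy (q : ℝ) :
    shannonEntropy q p X - shannonCondEntropy q p X Y =
      (∑ y, ∑ x, prob p X x * prob p Y y *
        InformationTheory.klFun (jointProb p X Y x y / (prob p X x * prob p Y y))) /
          Real.log q := by
  have term (x : A) (y : B) : prob p X x * prob p Y y *
        InformationTheory.klFun (jointProb p X Y x y / (prob p X x * prob p Y y)) =
      jointProb p X Y x y * Real.log (jointProb p X Y x y / prob p Y y) -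
        jointProb p X Y x y * Real.log (prob p X x) +
        (prob p X x * prob p Y y - jointProb p X Y x y) := by
    rcases (jointProb_nonneg p X Y x y).eq_or_lt with h | hxy
    · simp [← h, InformationTheory.klFun_zero]
    have hx := hxy.trans_le (jointProb_le_prob_left p X Y x y)
    have hy := hxy.trans_le (jointProb_le_prob_right p X Y x y)
    rw [InformationTheory.klFun_apply, Real.log_div hxy.ne' (mul_pos hx hy).ne',
      Real.log_mul hx.ne' hy.ne', Real.log_div hxy.ne' hy.ne']
    field_simp
    ring
  have entropy : ∑ y, ∑ x, jointProb p X Y x y * Real.log (prob p X x) =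
      -∑ x, Real.negMulLog (prob p X x) := by
    rw [Finset.sum_comm]
    simp_rw [← Finset.sum_mul, sum_jointProb_right, Real.negMulLog, neg_mul,
      Finset.sum_neg_distrib, neg_neg]
  have mass : ∑ y, ∑ x, (prob p X x * prob p Y y - jointProb p X Y x y) = 0 := by
    simp_rw [Finset.sum_sub_distrib, ← Finset.sum_mul, sum_prob, sum_jointProb_left, one_mul,
      sub_self]
  rw [shannonEntropy, shannonCondEntropy, ← sub_div]
  simp_rw [term, Finset.sum_add_distrib, mass, Finset.sum_sub_distrib, entropy,
    Finset.sum_neg_distrib]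
  simp only [jointProb, prob]
  ring

theorem shannonCondEntropy_eq_shannonEntropy_iff {q : ℝ} (hq : 1 < q) :
    shannonCondEntropy q p X Y = shannonEntropy q p X ↔
      ∀ x y, jointProb p X Y x y = prob p X x * prob p Y y := by
  have prod_nonneg (x : A) (y : B) : 0 ≤ prob p X x * prob p Y y :=
    mul_nonneg (prob_nonneg p X x) (prob_nonneg p Y y)
  have ratio_nonneg (x : A) (y : B) :=
    div_nonneg (jointProb_nonneg p X Y x y) (prod_nonneg x y)
  rw [eq_comm, ← sub_eq_zero, shannonEntropy_sub_shannonCondEntropy, div_eq_zero_iff,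
    or_iff_left (Real.log_pos hq).ne', sum_sum_eq_zero_iff_of_nonneg fun x y =>
      mul_nonneg (prod_nonneg x y) (InformationTheory.klFun_nonneg (ratio_nonneg x y))]
  refine forall₂_congr fun x y => ?_
  rw [mul_eq_zero, InformationTheory.klFun_eq_zero_iff (ratio_nonneg x y)]
  rcases (prod_nonneg x y).eq_or_lt with h | h
  · have joint_eq_zero : jointProb p X Y x y = 0 := by
      refine le_antisymm ?_ (jointProb_nonneg ..)
      rcases mul_eq_zero.1 h.symm with hx | hy
      · exact (jointProb_le_prob_left ..).trans_eq hx
      · exact (jointProb_le_prob_right ..).trans_eq hy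
    exact iff_of_true (.inl h.symm) (joint_eq_zero.trans h)
  · rw [or_iff_right h.ne', div_eq_one_iff_eq h.ne']

end Entropy

section PairLaw

variable {A B C : Type*} (μ : PMF A) (κ : A → PMF C)

/-- The law of a pair of random variables, the first of which has law `μ`, and the second of which
has law `κ a` given that the first one equals `a`. -/
noncomputable def pairLaw : PMF (A × C) := μ.bind fun a => (κ a).map fun c => (a, c)

theorem map_pairLaw (f : A × C → B) :
    (pairLaw μ κ).map f = μ.bind fun a => (κ a).map fun c => f (a, c) := by
  simp only [pairLaw, PMF.map_bind, PMF.map_comp]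
  rfl

theorem map_fst_pairLaw : (pairLaw μ κ).map Prod.fst = μ := by
  rw [map_pairLaw]
  exact (congrArg μ.bind (funext fun a => PMF.map_const (κ a) a)).trans (PMF.bind_pure μ)

theorem mem_support_pairLaw_iff {a : A} {c : C} :
    (a, c) ∈ (pairLaw μ κ).support ↔ a ∈ μ.support ∧ c ∈ (κ a).support := by
  simp [pairLaw, -PMF.mem_support_iff, and_comm]

theorem jointProb_pairLaw_fst (Y : A × C → B) (a : A) (y : B) :
    jointProb (pairLaw μ κ) Prod.fst Y a y = (μ a).toReal * prob (κ a) (fun c => Y (a, c)) y := by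
  have vanish (a' : A) (h : a' ≠ a) :
      ((κ a').map fun c => (a', Y (a', c))) (a, y) = 0 := by
    simp [PMF.map_apply, h.symm]
  have diagonal : ((κ a).map fun c => (a, Y (a, c))) (a, y) =
      ((κ a).map fun c => Y (a, c)) y := by
    simp only [PMF.map_apply]
    refine tsum_congr fun c => ?_
    congr 1
    exact propext Prod.mk_right_inj
  rw [jointProb, prob, map_pairLaw, PMF.bind_apply, tsum_eq_single a fun a' h => by
    rw [vanish a' h, mul_zero], diagonal, ENNReal.toReal_mul, prob]

theorem shannonCondEntropy_pairLaw_fst_eq_iff [Fintype A] [Fintype B] {q : ℝ} (hq : 1 < q)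
    (hμ : ∀ a, μ a ≠ 0) (Y : A × C → B) :
    shannonCondEntropy q (pairLaw μ κ) Prod.fst Y = shannonEntropy q (pairLaw μ κ) Prod.fst ↔
      ∀ a a', ((κ a).map fun c => Y (a, c)) = (κ a').map fun c => Y (a', c) := by
  have prob_fst (a : A) : prob (pairLaw μ κ) Prod.fst a = (μ a).toReal := by
    rw [prob, map_fst_pairLaw]
  simp only [shannonCondEntropy_eq_shannonEntropy_iff _ _ _ hq, jointProb_pairLaw_fst, prob_fst,
    mul_right_inj' (ENNReal.toReal_ne_zero.2 ⟨hμ _, PMF.apply_ne_top _ _⟩)]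
  constructor
  · intro h a a'
    ext y
    exact (ENNReal.toReal_eq_toReal_iff' (PMF.apply_ne_top _ _) (PMF.apply_ne_top _ _)).1
      ((h a y).trans (h a' y).symm)
  · intro h a y
    simp only [prob, map_pairLaw, h _ a, PMF.bind_const]

theorem map_uniformOfFintype_equiv [Fintype A] [Nonempty A] [Fintype B] [Nonempty B] (e : A ≃ B) :
    (PMF.uniformOfFintype A).map e = PMF.uniformOfFintype B := by
  classical
  ext y
  simp [PMF.map_apply, ← e.symm_apply_eq, Fintype.card_congr e]

theorem shannonEntropy_of_map_eq_uniformOfFintype [Fintype A] [Nonempty A] {q : ℝ} {p : PMF C}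
    {X : C → A} (hX : p.map X = PMF.uniformOfFintype A) :
    shannonEntropy q p X = Real.log (Fintype.card A) / Real.log q := by
  simp [shannonEntropy, hX, Real.negMulLog]

end PairLaw

namespace StorageScheme

section InformationTheory

variable {F : Type} [Field F] [Fintype F] {n d a b R : ℕ} (sch : StorageScheme F n d a b R)

theorem law_eq_pairLaw : sch.law = pairLaw (PMF.uniformOfFintype (Fin R → F)) sch.encode := rfl

theorem fileEntropy_eq : sch.fileEntropy = R := by
  have hlog : Real.log (Fintype.card F) ≠ 0 :=
    (Real.log_pos (Nat.one_lt_cast.2 Fintype.one_lt_card)).ne'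
  rw [fileEntropy, law_eq_pairLaw, shannonEntropy_of_map_eq_uniformOfFintype (map_fst_pairLaw ..)]
  simp [hlog]

theorem mem_support_law_iff {s : Fin R → F} {c : Fin n → Fin a → F} :
    (s, c) ∈ sch.law.support ↔ c ∈ (sch.encode s).support := by
  rw [law_eq_pairLaw, mem_support_pairLaw_iff,
    and_iff_right (PMF.mem_support_uniformOfFintype s)]

theorem reconstructs_iff {k : ℕ} :
    sch.Reconstructs k ↔ ∀ (σ : ℕ → RepairEvent n d) (t : ℕ) (B : Finset (Fin n)), B.card = k →
      ∀ s, ∀ c ∈ (sch.encode s).support, ∀ s', ∀ c' ∈ (sch.encode s').support,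
        (∀ i ∈ B, sch.stored σ t (s, c) i = sch.stored σ t (s', c') i) → s = s' := by
  simp only [Reconstructs, shannonCondEntropy_eq_zero_iff _ _ _
    (Nat.one_lt_cast.2 (Fintype.one_lt_card (α := F))), Prod.forall, mem_support_law_iff,
    funext_iff, Subtype.forall]

theorem secure_iff {ℓ : ℕ} :
    sch.Secure ℓ ↔ ∀ (σ : ℕ → RepairEvent n d) (E : Finset (Fin n ⊕ ℕ)), E.card ≤ ℓ → ∀ s s',
      ((sch.encode s).map fun c (v : {v // v ∈ E}) => sch.revealed σ (s, c) v) =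
        (sch.encode s').map fun c (v : {v // v ∈ E}) => sch.revealed σ (s', c) v :=
  forall₃_congr fun _ _ _ => shannonCondEntropy_pairLaw_fst_eq_iff _ _
    (Nat.one_lt_cast.2 Fintype.one_lt_card)
    (fun s => (PMF.mem_support_iff _ s).1 (PMF.mem_support_uniformOfFintype s)) _

end InformationTheory

end StorageScheme

section Converse

variable {n d : ℕ}

/-- The failure pattern in which the slots `0, …, d` fail periodically in this order and are
repaired from each other. -/
def sequentialRepairs (hd : d < n) (t : ℕ) : RepairEvent n d where
  failed := Fin.castLE hd (Fin.ofNat (d + 1) t)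
  helpers := (Finset.univ.erase (Fin.ofNat (d + 1) t)).map (Fin.castLEEmb hd)
  card_helpers := by
    rw [Finset.card_map, Finset.card_erase_of_mem (Finset.mem_univ _), Finset.card_fin]
    rfl
  failed_notMem := by simp

theorem val_failed_sequentialRepairs (hd : d < n) {t : ℕ} (ht : t ≤ d) :
    ((sequentialRepairs hd t).failed : ℕ) = t :=
  Nat.mod_eq_of_lt (Nat.lt_succ_of_le ht)

theorem val_le_of_mem_helpers_sequentialRepairs (hd : d < n) {t : ℕ} {j : Fin n} :
    j ∈ (sequentialRepairs hd t).helpers → (j : ℕ) ≤ d := by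
  simp only [sequentialRepairs, Finset.mem_map, forall_exists_index, and_imp]
  rintro i _ rfl
  exact i.is_le

namespace StorageScheme

variable {F : Type} [Field F] {a b R k ℓ : ℕ} {sch : StorageScheme F n d a b R}
  {ω ω' : (Fin R → F) × (Fin n → Fin a → F)}

theorem stored_eq_of_forall_failed_ne {σ : ℕ → RepairEvent n d} {i : Fin n} {s t : ℕ} (hst : s ≤ t)
    (h : ∀ u, s ≤ u → u < t → (σ u).failed ≠ i) : sch.stored σ t ω i = sch.stored σ s ω i := by
  induction t, hst using Nat.le_induction with
  | base => rfl
  | succ t hst ih =>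
    rw [stored, Function.update_of_ne (h t hst t.lt_succ_self).symm,
      ih fun u hsu hut => h u hsu (hut.trans t.lt_succ_self)]

theorem stored_sequentialRepairs (hd : d < n) {i : Fin n} {t : ℕ} (hit : (i : ℕ) < t)
    (ht : t ≤ d + 1) :
    sch.stored (sequentialRepairs hd) t ω i =
      sch.regenerate (pastEvents (sequentialRepairs hd) i) (sequentialRepairs hd i)
        (sch.download (sequentialRepairs hd) i (sch.stored (sequentialRepairs hd) i ω)) := by
  have failed_eq : (sequentialRepairs hd i).failed = i :=
    Fin.ext (val_failed_sequentialRepairs hd (by omega))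
  have unchanged : sch.stored (sequentialRepairs hd) t ω i =
      sch.stored (sequentialRepairs hd) (i + 1) ω i := by
    refine stored_eq_of_forall_failed_ne hit fun u hiu hut hfailed => ?_
    have := val_failed_sequentialRepairs hd (t := u) (by omega)
    omega
  rw [unchanged, stored, failed_eq, Function.update_self]

theorem download_sequentialRepairs_eq (hd : d < n) (hk : k ≤ d + 1)
    (h : ∀ t < k, ∀ j : Fin n, t < j →
      sch.download (sequentialRepairs hd) t (sch.stored (sequentialRepairs hd) t ω) j =
        sch.download (sequentialRepairs hd) t (sch.stored (sequentialRepairs hd) t ω') j)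
    {t : ℕ} (ht : t < k) :
    sch.download (sequentialRepairs hd) t (sch.stored (sequentialRepairs hd) t ω) =
      sch.download (sequentialRepairs hd) t (sch.stored (sequentialRepairs hd) t ω') := by
  induction t using Nat.strong_induction_on with
  | _ t ih =>
    funext j
    rcases lt_trichotomy (j : ℕ) t with hjt | hjt | hjt
    · have stored_eq : sch.stored (sequentialRepairs hd) t ω j =
          sch.stored (sequentialRepairs hd) t ω' j := by
        rw [stored_sequentialRepairs hd hjt (by omega), stored_sequentialRepairs hd hjt (by omega),
          ih j hjt (hjt.trans ht)]
      simp only [download, stored_eq]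
    · have failed_eq : (sequentialRepairs hd t).failed = j :=
        Fin.ext ((val_failed_sequentialRepairs hd (by omega)).trans hjt.symm)
      simp only [download, ← failed_eq, (sequentialRepairs hd t).failed_notMem, if_false]
    · exact h t ht j hjt

variable [Fintype F]

theorem Reconstructs.eq_of_download_eq (hsch : sch.Reconstructs k) (hd : d < n) (hk : k ≤ d + 1)
    {s s' : Fin R → F} {c c' : Fin n → Fin a → F} (hc : c ∈ (sch.encode s).support)
    (hc' : c' ∈ (sch.encode s').support)
    (h : ∀ t < k,
      sch.download (sequentialRepairs hd) t (sch.stored (sequentialRepairs hd) t (s, c)) =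
        sch.download (sequentialRepairs hd) t (sch.stored (sequentialRepairs hd) t (s', c'))) :
    s = s' := by
  refine (reconstructs_iff sch).1 hsch (sequentialRepairs hd) k
    (Finset.univ.map (Fin.castLEEmb (hk.trans hd))) (by simp) s c hc s' c' hc' ?_
  simp only [Finset.mem_map, forall_exists_index, and_imp]
  rintro _ i - rfl
  rw [stored_sequentialRepairs hd i.is_lt hk, stored_sequentialRepairs hd i.is_lt hk]
  exact congrArg _ (h i i.is_lt)

theorem Secure.exists_download_eq (hsch : sch.Secure ℓ) (σ : ℕ → RepairEvent n d)
    {s : Fin R → F} {c : Fin n → Fin a → F} (hc : c ∈ (sch.encode s).support) (s' : Fin R → F) :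
    ∃ c' ∈ (sch.encode s').support, ∀ t < ℓ,
      sch.download σ t (sch.stored σ t (s', c')) = sch.download σ t (sch.stored σ t (s, c)) := by
  have same_law := (secure_iff sch).1 hsch σ ((Finset.range ℓ).map Function.Embedding.inr)
    (by simp) s s'
  obtain ⟨c', hc', heq⟩ := (PMF.mem_support_map_iff ..).1 <|
    same_law ▸ (PMF.mem_support_map_iff _ _ _).2 ⟨c, hc, rfl⟩
  exact ⟨c', hc', fun t ht => Sum.inr_injective (congrFun heq ⟨Sum.inr t, by simpa using ht⟩)⟩

theorem fileSize_le (hrec : sch.Reconstructs k) (hsec : sch.Secure ℓ) (hd : d < n)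
    (hk : k ≤ d + 1) : R ≤ ∑ i ∈ Finset.Icc (ℓ + 1) k, (d + 1 - i) * b := by
  obtain ⟨c₀, hc₀⟩ := (sch.encode 0).support_nonempty
  choose c hc hdownload using hsec.exists_download_eq (sequentialRepairs hd) hc₀
  let links := (Finset.Icc (ℓ + 1) k).sigma fun i => Finset.Ico i (d + 1)
  have slot_lt (x : links) : x.1.2 < n :=
    (Finset.mem_Ico.1 (Finset.mem_sigma.1 x.2).2).2.trans_le hd
  let messages (s : Fin R → F) (x : links) : Fin b → F :=
    sch.download (sequentialRepairs hd) (x.1.1 - 1)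
      (sch.stored (sequentialRepairs hd) (x.1.1 - 1) (s, c s)) ⟨x.1.2, slot_lt x⟩
  have messages_injective : Function.Injective messages := by
    intro s s' hmessages
    refine hrec.eq_of_download_eq hd hk (hc s) (hc s') fun t ht =>
      download_sequentialRepairs_eq hd hk (fun t ht j htj => ?_) ht
    rcases lt_or_ge t ℓ with htℓ | hℓt
    · rw [hdownload s t htℓ, hdownload s' t htℓ]
    by_cases hj : (j : ℕ) ≤ d
    · exact congrFun hmessages ⟨⟨t + 1, j⟩, by simp [links]; omega⟩
    · have not_helper := mt (val_le_of_mem_helpers_sequentialRepairs hd (t := t)) hj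
      simp only [download, not_helper, if_false]
  have card_le := Fintype.card_le_of_injective messages messages_injective
  simpa [links, ← pow_mul, Nat.pow_le_pow_iff_right Fintype.one_lt_card, mul_comm b,
    Finset.sum_mul] using card_le

end StorageScheme

end Converse

section NestedReedSolomon

open Polynomial

variable {F ι : Type*} [Field F] [DecidableEq F] {K N : ℕ} {x : ι → F} {T : Finset ι}

/-- The polynomial whose `K` lowest coefficients are the keys `r`, followed by the coefficients
`s` of a message.  Its values are the symbols of a nested Reed-Solomon codeword. -/
noncomputable def nestedPoly (r : Fin K → F) (s : Fin N → F) : F[X] :=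
  ofFn K r + X ^ K * ofFn N s

theorem degree_nestedPoly_lt (r : Fin K → F) (s : Fin N → F) :
    (nestedPoly r s).degree < (K + N : ℕ) := by
  refine (degree_add_le _ _).trans_lt (max_lt ?_ ?_)
  · exact (ofFn_degree_lt r).trans_le (Nat.cast_le.2 (Nat.le_add_right K N))
  · rw [degree_mul, degree_X_pow, Nat.cast_add]
    exact WithBot.add_lt_add_left (WithBot.natCast_ne_bot K) (ofFn_degree_lt s)

theorem coeff_nestedPoly_add (r : Fin K → F) (s : Fin N → F) (i : Fin N) :
    (nestedPoly r s).coeff (i + K) = s i := by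
  rw [nestedPoly, coeff_add, ofFn_coeff_eq_zero_of_ge _ (Nat.le_add_left K i), zero_add,
    coeff_X_pow_mul, ofFn_coeff_eq_val_of_lt _ i.is_lt]

theorem eq_of_forall_eval_nestedPoly_eq (hx : Set.InjOn x T) (hT : K + N ≤ T.card)
    {r r' : Fin K → F} {s s' : Fin N → F}
    (h : ∀ t ∈ T, (nestedPoly r s).eval (x t) = (nestedPoly r' s').eval (x t)) : s = s' := by
  have degree_lt (r : Fin K → F) (s : Fin N → F) : (nestedPoly r s).degree < T.card :=
    (degree_nestedPoly_lt r s).trans_le (Nat.cast_le.2 hT)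
  have poly_eq := eq_of_degrees_lt_of_eval_index_eq T hx (degree_lt r s) (degree_lt r' s') h
  funext i
  rw [← coeff_nestedPoly_add r s, poly_eq, coeff_nestedPoly_add]

theorem ofFn_toFn_of_degree_lt {p : F[X]} (hp : p.degree < K) : ofFn K (toFn K p) = p := by
  ext i
  rcases lt_or_ge i K with hi | hi
  · exact ofFn_coeff_eq_val_of_lt _ hi
  · rw [ofFn_coeff_eq_zero_of_ge _ hi, coeff_eq_zero_of_degree_lt (hp.trans_le (Nat.cast_le.2 hi))]

theorem exists_forall_eval_nestedPoly_add_eq (hx : Set.InjOn x T) (hT : T.card ≤ K)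
    (s s' : Fin N → F) : ∃ r₀ : Fin K → F, ∀ r, ∀ t ∈ T,
      (nestedPoly r s).eval (x t) = (nestedPoly (r + r₀) s').eval (x t) := by
  classical
  let correction := Lagrange.interpolate T x fun t =>
    (nestedPoly (0 : Fin K → F) s - nestedPoly (0 : Fin K → F) s').eval (x t)
  have degree_lt : correction.degree < K :=
    (Lagrange.degree_interpolate_lt _ hx).trans_le (Nat.cast_le.2 hT)
  refine ⟨toFn K correction, fun r t ht => ?_⟩
  have eval_correction :
      correction.eval (x t) = (X ^ K * ofFn N s).eval (x t) - (X ^ K * ofFn N s').eval (x t) :=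
    (Lagrange.eval_interpolate_at_node _ hx ht).trans (by simp [nestedPoly])
  rw [nestedPoly, nestedPoly, map_add, ofFn_toFn_of_degree_lt degree_lt, eval_add,
    eval_add, eval_add, eval_correction]
  ring

variable {R b : ℕ} (φ : Fin R ≃ Fin N × Fin b)

/-- Encoding of a file `s` by `b` parallel nested Reed-Solomon codes with keys `r`; `φ` distributes
the symbols of the file among them, and position `e` carries their values at the point `x e`. -/
noncomputable def nestedCodeword (x : ι → F) (s : Fin R → F) (r : Fin b → Fin K → F)
    (e : ι) (p : Fin b) : F :=
  (nestedPoly (r p) fun v => s (φ.symm (v, p))).eval (x e)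

theorem eq_of_forall_nestedCodeword_eq (hx : Set.InjOn x T)
    (hT : K + N ≤ T.card) {s s' : Fin R → F} {r r' : Fin b → Fin K → F}
    (h : ∀ e ∈ T, nestedCodeword φ x s r e = nestedCodeword φ x s' r' e) : s = s' := by
  funext m
  have := congrFun (eq_of_forall_eval_nestedPoly_eq hx hT fun e he => congrFun (h e he) (φ m).2)
    (φ m).1
  simpa using this

theorem exists_forall_nestedCodeword_add_eq (hx : Set.InjOn x T)
    (hT : T.card ≤ K) (s s' : Fin R → F) : ∃ r₀ : Fin b → Fin K → F, ∀ r, ∀ e ∈ T,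
      nestedCodeword φ x s r e = nestedCodeword φ x s' (r + r₀) e := by
  choose r₀ hr₀ using fun p => exists_forall_eval_nestedPoly_add_eq hx hT
    (fun v => s (φ.symm (v, p))) (fun v => s' (φ.symm (v, p)))
  exact ⟨r₀, fun r e he => funext fun p => hr₀ p (r p) e he⟩

theorem map_indicator_nestedCodeword_eq [Fintype F] {T : Finset ι}
    (hx : Set.InjOn x T) (hT : T.card ≤ K) (s s' : Fin R → F) :
    ((PMF.uniformOfFintype (Fin b → Fin K → F)).map (nestedCodeword φ x s)).map
        (T : Set ι).indicator =
      ((PMF.uniformOfFintype (Fin b → Fin K → F)).map (nestedCodeword φ x s')).map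
        (T : Set ι).indicator := by
  obtain ⟨r₀, hr₀⟩ := exists_forall_nestedCodeword_add_eq φ hx hT s s'
  have shift : (T : Set ι).indicator ∘ nestedCodeword φ x s =
      ((T : Set ι).indicator ∘ nestedCodeword φ x s') ∘ Equiv.addRight r₀ :=
    funext fun r => Set.indicator_congr fun e he => hr₀ r e he
  rw [PMF.map_comp, PMF.map_comp, shift, ← PMF.map_comp, map_uniformOfFintype_equiv]

end NestedReedSolomon

section IncidentEdges

variable {V : Type*} [Fintype V] [DecidableEq V]

/-- The edges of the complete graph on `V` with an endpoint in `B`. -/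
def incidentEdges (B : Finset V) : Finset (Sym2 V) :=
  Finset.univ.filter fun e => ¬e.IsDiag ∧ ∃ i ∈ B, i ∈ e

theorem forall_mem_incidentEdges {B : Finset V} {P : Sym2 V → Prop} :
    (∀ e ∈ incidentEdges B, P e) ↔ ∀ i ∈ B, ∀ j ≠ i, P s(i, j) := by
  simp only [incidentEdges, Finset.mem_filter, Finset.mem_univ, true_and]
  constructor
  · intro h i hi j hji
    exact h _ ⟨mt Sym2.mk_isDiag_iff.1 hji.symm, i, hi, Sym2.mem_mk_left i j⟩
  · rintro h _ ⟨hdiag, i, hi, j, rfl⟩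
    exact h i hi j fun hji => hdiag (Sym2.mk_isDiag_iff.2 hji.symm)

theorem not_isDiag_of_mem_incidentEdges {B : Finset V} {e : Sym2 V} (he : e ∈ incidentEdges B) :
    ¬e.IsDiag :=
  (Finset.mem_filter.1 he).2.1

theorem incidentEdges_insert (i : V) (B : Finset V) :
    incidentEdges (insert i B) = incidentEdges B ∪ (insert i B)ᶜ.image fun j => s(i, j) := by
  ext e
  induction e with | _ u v
  simp only [incidentEdges, Finset.mem_filter, Finset.mem_univ, Finset.mem_union, Finset.mem_image,
    Finset.mem_compl, Finset.mem_insert, exists_eq_or_imp, Sym2.mk_isDiag_iff,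
    Sym2.mem_iff, Sym2.eq_iff]
  grind

theorem card_incidentEdges (B : Finset V) :
    (incidentEdges B).card = ∑ i ∈ Finset.Icc 1 B.card, (Fintype.card V - i) := by
  induction B using Finset.induction_on with
  | empty => simp [incidentEdges]
  | insert i B hi ih =>
    have disjoint : Disjoint (incidentEdges B) ((insert i B)ᶜ.image fun j => s(i, j)) := by
      simp only [Finset.disjoint_right, Finset.forall_mem_image, incidentEdges, Finset.mem_filter,
        Finset.mem_compl, Finset.mem_insert, Sym2.mem_iff]
      grind
    have injective : Function.Injective fun j => s(i, j) := fun _ _ => Sym2.congr_right.1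
    rw [incidentEdges_insert, Finset.card_union_of_disjoint disjoint,
      Finset.card_image_of_injective _ injective, Finset.card_compl, ih,
      Finset.card_insert_of_notMem hi, Finset.sum_Icc_succ_top (Nat.le_add_left 1 _)]

end IncidentEdges

theorem RepairEvent.mem_helpers_iff {d : ℕ} (e : RepairEvent (d + 1) d) {j : Fin (d + 1)} :
    j ∈ e.helpers ↔ j ≠ e.failed := by
  have subset : e.helpers ⊆ Finset.univ.erase e.failed := fun i hi =>
    Finset.mem_erase.2 ⟨ne_of_mem_of_not_mem hi e.failed_notMem, Finset.mem_univ i⟩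
  have helpers_eq : e.helpers = Finset.univ.erase e.failed :=
    Finset.eq_of_subset_of_card_le subset (by simp [e.card_helpers])
  simp [helpers_eq]

section RepairByTransfer

variable {F : Type} {d a b R : ℕ} (idx : ∀ i : Fin (d + 1), Fin a ≃ {j // j ≠ i} × Fin b)
  {w w' : Sym2 (Fin (d + 1)) → Fin b → F} {s s' : Fin R → F}

/-- The node contents when every edge `e` of the complete graph carries the symbols `w e` and each
node stores the symbols on its edges; `idx i` names the edge and the position on it whose symbol
is stored in a given cell of node `i`. -/
def edgeContents (w : Sym2 (Fin (d + 1)) → Fin b → F) (i : Fin (d + 1)) (m : Fin a) : F :=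
  w s(i, (idx i m).1) (idx i m).2

theorem forall_edgeContents_eq_iff {B : Finset (Fin (d + 1))} :
    (∀ i ∈ B, edgeContents idx w i = edgeContents idx w' i) ↔
      ∀ e ∈ incidentEdges B, w e = w' e := by
  rw [forall_mem_incidentEdges]
  refine forall₂_congr fun i _ => ?_
  simp only [funext_iff, edgeContents, (idx i).forall_congr_left, Equiv.apply_symm_apply,
    Prod.forall, Subtype.forall]

variable [Field F] (κ : (Fin R → F) → PMF (Sym2 (Fin (d + 1)) → Fin b → F))

/-- Repair by transfer: for a file `s` the edges of the complete graph are labelled according to the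
law `κ s`, both endpoints of an edge store its label, and a repair copies each label of the failed
node from the other endpoint. -/
noncomputable def repairByTransfer : StorageScheme F (d + 1) d a b R where
  encode s := (κ s).map (edgeContents idx)
  send _ e j c := fun p => if h : e.failed ≠ j then c ((idx j).symm (⟨e.failed, h⟩, p)) else 0
  regenerate _ e D m := D (idx e.failed m).1 (idx e.failed m).2

theorem download_repairByTransfer (σ : ℕ → RepairEvent (d + 1) d) (t : ℕ) :
    (repairByTransfer idx κ).download σ t (edgeContents idx w) =
      fun j => if j = (σ t).failed then 0 else w s((σ t).failed, j) := by
  funext j p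
  by_cases hj : j = (σ t).failed
  · simp [StorageScheme.download, RepairEvent.mem_helpers_iff, hj]
  · simp [StorageScheme.download, RepairEvent.mem_helpers_iff, hj, Ne.symm hj, repairByTransfer,
      edgeContents, Sym2.eq_swap]

theorem stored_repairByTransfer (σ : ℕ → RepairEvent (d + 1) d) (t : ℕ) :
    (repairByTransfer idx κ).stored σ t (s, edgeContents idx w) = edgeContents idx w := by
  induction t with
  | zero => rfl
  | succ t ih =>
    rw [StorageScheme.stored, ih, Function.update_eq_self_iff, download_repairByTransfer]
    funext m
    exact congrFun (if_neg (idx (σ t).failed m).1.2) _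

theorem revealed_repairByTransfer_eq (σ : ℕ → RepairEvent (d + 1) d) {B : Finset (Fin (d + 1))}
    (h : ∀ e ∈ incidentEdges B, w e = w' e) {v : Fin (d + 1) ⊕ ℕ}
    (hv : Sum.elim id (fun t => (σ t).failed) v ∈ B) :
    (repairByTransfer idx κ).revealed σ (s, edgeContents idx w) v =
      (repairByTransfer idx κ).revealed σ (s', edgeContents idx w') v := by
  rcases v with i | t
  · exact congrArg Sum.inl ((forall_edgeContents_eq_iff idx).2 h i hv)
  · simp only [StorageScheme.revealed, stored_repairByTransfer, download_repairByTransfer]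
    refine congrArg Sum.inr (funext fun j => ?_)
    split_ifs with hj
    · rfl
    · exact forall_mem_incidentEdges.1 h _ hv j hj

variable [Fintype F]

theorem reconstructs_repairByTransfer {k : ℕ}
    (h : ∀ B : Finset (Fin (d + 1)), B.card = k →
      ∀ s, ∀ w ∈ (κ s).support, ∀ s', ∀ w' ∈ (κ s').support,
        (∀ e ∈ incidentEdges B, w e = w' e) → s = s') :
    (repairByTransfer idx κ).Reconstructs k := by
  refine (StorageScheme.reconstructs_iff _).2 fun σ t B hB s c hc s' c' hc' hagree => ?_
  obtain ⟨w, hw, rfl⟩ := (PMF.mem_support_map_iff ..).1 hc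
  obtain ⟨w', hw', rfl⟩ := (PMF.mem_support_map_iff ..).1 hc'
  simp only [stored_repairByTransfer] at hagree
  exact h B hB s w hw s' w' hw' ((forall_edgeContents_eq_iff idx).1 hagree)

theorem secure_repairByTransfer {ℓ : ℕ}
    (h : ∀ B : Finset (Fin (d + 1)), B.card ≤ ℓ → ∀ s s',
      (κ s).map (incidentEdges B : Set (Sym2 (Fin (d + 1)))).indicator =
        (κ s').map (incidentEdges B : Set (Sym2 (Fin (d + 1)))).indicator) :
    (repairByTransfer idx κ).Secure ℓ := by
  refine (StorageScheme.secure_iff _).2 fun σ E hE s s' => ?_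
  let B := E.image (Sum.elim id fun t => (σ t).failed)
  let observed (w : Sym2 (Fin (d + 1)) → Fin b → F) (v : {v // v ∈ E}) :=
    (repairByTransfer idx κ).revealed σ (0, edgeContents idx w) v
  have observed_eq (s : Fin R → F) (w : Sym2 (Fin (d + 1)) → Fin b → F) :
      (fun v : {v // v ∈ E} => (repairByTransfer idx κ).revealed σ (s, edgeContents idx w) v) =
        observed ((incidentEdges B : Set (Sym2 (Fin (d + 1)))).indicator w) :=
    funext fun v => revealed_repairByTransfer_eq idx κ σ
      (fun e he => (Set.indicator_of_mem (Finset.mem_coe.2 he) w).symm)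
      (Finset.mem_image_of_mem _ v.2)
  have law_eq (s : Fin R → F) :
      (((repairByTransfer idx κ).encode s).map fun c (v : {v // v ∈ E}) =>
        (repairByTransfer idx κ).revealed σ (s, c) v) =
        ((κ s).map (incidentEdges B : Set (Sym2 (Fin (d + 1)))).indicator).map observed := by
    rw [PMF.map_comp]
    exact (PMF.map_comp ..).trans (congrArg (PMF.map · (κ s)) (funext (observed_eq s)))
  rw [law_eq, law_eq, h B (Finset.card_image_le.trans hE) s s']

end RepairByTransfer

theorem exists_injOn_not_isDiag {V F : Type*} [Fintype V] [Fintype F] [Nonempty F]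
    (h : (Fintype.card V).choose 2 ≤ Fintype.card F) :
    ∃ x : Sym2 V → F, Set.InjOn x {e | ¬e.IsDiag} := by
  classical
  obtain ⟨f⟩ := Function.Embedding.nonempty_of_card_le
    (α := {e : Sym2 V // ¬e.IsDiag}) (Sym2.card_subtype_not_diag.trans_le h)
  exact Set.exists_injOn_iff_injective.2 ⟨f, f.injective⟩

theorem exists_reconstructs_secure (F : Type) [Field F] [Fintype F] {d k ℓ : ℕ} (b : ℕ)
    (hℓ : ℓ ≤ k) (hF : (d + 1).choose 2 ≤ Fintype.card F) :
    ∃ sch : StorageScheme F (d + 1) d (d * b) b (∑ i ∈ Finset.Icc (ℓ + 1) k, (d + 1 - i) * b),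
      sch.Reconstructs k ∧ sch.Secure ℓ := by
  classical
  let K := ∑ i ∈ Finset.Icc 1 ℓ, (d + 1 - i)
  let N := ∑ i ∈ Finset.Icc (ℓ + 1) k, (d + 1 - i)
  have key_add_message : K + N = ∑ i ∈ Finset.Icc 1 k, (d + 1 - i) := by
    simpa only [← Finset.Icc_add_one_left_eq_Ioc, Nat.zero_add] using
      Finset.sum_Ioc_consecutive (fun i => d + 1 - i) (Nat.zero_le ℓ) hℓ
  obtain ⟨x, hx⟩ := exists_injOn_not_isDiag (V := Fin (d + 1)) (F := F) (by rwa [Fintype.card_fin])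
  have injOn_incidentEdges (B : Finset (Fin (d + 1))) : Set.InjOn x (incidentEdges B) :=
    hx.mono fun _ => not_isDiag_of_mem_incidentEdges
  have φ : Fin (∑ i ∈ Finset.Icc (ℓ + 1) k, (d + 1 - i) * b) ≃ Fin N × Fin b :=
    Fintype.equivOfCardEq (by simp [N, Finset.sum_mul])
  have idx (i : Fin (d + 1)) : Fin (d * b) ≃ {j // j ≠ i} × Fin b :=
    Fintype.equivOfCardEq (by simp [Fintype.card_subtype_compl])
  refine ⟨repairByTransfer idx fun s =>
      (PMF.uniformOfFintype (Fin b → Fin K → F)).map (nestedCodeword φ x s),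
    reconstructs_repairByTransfer _ _ fun B hB s w hw s' w' hw' hagree => ?_,
    secure_repairByTransfer _ _ fun B hB =>
      map_indicator_nestedCodeword_eq φ (injOn_incidentEdges B) ?_⟩
  · obtain ⟨r, -, rfl⟩ := (PMF.mem_support_map_iff ..).1 hw
    obtain ⟨r', -, rfl⟩ := (PMF.mem_support_map_iff ..).1 hw'
    refine eq_of_forall_nestedCodeword_eq φ (injOn_incidentEdges B) ?_ hagree
    rw [card_incidentEdges, hB, Fintype.card_fin, key_add_message]
  · rw [card_incidentEdges, Fintype.card_fin]
    exact Finset.sum_le_sum_of_subset (Finset.Icc_subset_Icc_right hB)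

section Capacity

variable {n d k ℓ : ℕ} {α γ Γ : ℝ}

/-- The secrecy capacity for repair bandwidth `γ`, ample storage and `d + 1` nodes.  When the
slots fail in succession, the term of index `i` counts the data units that the `i`-th replacement
node receives from nodes not yet replaced; the first `ℓ` replacement nodes are compromised. -/
noncomputable def bandwidthLimitedBound (d k ℓ : ℕ) (γ : ℝ) : ℝ :=
  ∑ i ∈ Finset.Icc (ℓ + 1) k, ((d : ℝ) + 1 - i) * (γ / d)

theorem bandwidthLimitedBound_eq (hk : k ≤ d + 1) (γ : ℝ) :
    bandwidthLimitedBound d k ℓ γ =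
      (∑ i ∈ Finset.Icc (ℓ + 1) k, (d + 1 - i) : ℕ) * (γ / d) := by
  rw [bandwidthLimitedBound, ← Finset.sum_mul, Nat.cast_sum]
  congr 1
  refine Finset.sum_congr rfl fun i hi => ?_
  rw [Nat.cast_sub ((Finset.mem_Icc.1 hi).2.trans hk), Nat.cast_add_one]

theorem bandwidthLimitedBound_mono (hk : k ≤ d + 1) : Monotone (bandwidthLimitedBound d k ℓ) := by
  intro γ Γ hγ
  rw [bandwidthLimitedBound_eq hk, bandwidthLimitedBound_eq hk]
  gcongr

section Field

variable (F : Type) [Field F] [Fintype F] {m : ℕ}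

theorem secrecyCapacityOver_le (hm : 0 < m) (hd₀ : 0 < d) (hd : d < n) (hk : k ≤ d + 1) :
    secrecyCapacityOver F m n k d ℓ α γ ≤ bandwidthLimitedBound d k ℓ γ := by
  refine iSup₂_le fun a b => iSup₂_le fun R sch => iSup_le ?_
  rintro ⟨-, hb, hrec, hsec⟩
  have link_le : (b : ℝ) / m ≤ γ / d := by
    rw [div_le_div_iff₀ (Nat.cast_pos.2 hm) (Nat.cast_pos.2 hd₀)]
    linarith
  have size_le : (R : ℝ) ≤ (∑ i ∈ Finset.Icc (ℓ + 1) k, (d + 1 - i) : ℕ) * b := by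
    rw [← Nat.cast_mul, Nat.cast_le, Finset.sum_mul]
    exact StorageScheme.fileSize_le hrec hsec hd hk
  rw [EReal.coe_le_coe_iff, sch.fileEntropy_eq, bandwidthLimitedBound_eq hk]
  calc (R : ℝ) / m ≤ (∑ i ∈ Finset.Icc (ℓ + 1) k, (d + 1 - i) : ℕ) * b / m := by gcongr
    _ = (∑ i ∈ Finset.Icc (ℓ + 1) k, (d + 1 - i) : ℕ) * (b / m) := mul_div_assoc ..
    _ ≤ _ := by gcongr

theorem bandwidthLimitedCapacityOver_le (hm : 0 < m) (hd₀ : 0 < d) (hd : d < n) (hk : k ≤ d + 1) :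
    bandwidthLimitedCapacityOver F m n k d ℓ Γ ≤ bandwidthLimitedBound d k ℓ Γ :=
  iSup₂_le fun _ hγ => iSup₂_le fun _ _ => (secrecyCapacityOver_le F hm hd₀ hd hk).trans <|
    EReal.coe_le_coe_iff.2 (bandwidthLimitedBound_mono hk hγ.2)

theorem secrecyCapacityOver_le_bandwidthLimitedCapacityOver (hΓ : 0 ≤ Γ) :
    secrecyCapacityOver F m n k d ℓ Γ Γ ≤ bandwidthLimitedCapacityOver F m n k d ℓ Γ :=
  le_iSup₂_of_le Γ ⟨hΓ, le_rfl⟩ <| le_iSup₂_of_le Γ hΓ le_rfl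

theorem le_secrecyCapacityOver {b : ℕ} (hℓ : ℓ ≤ k) (hF : (d + 1).choose 2 ≤ Fintype.card F)
    (hα : (d : ℝ) * b ≤ m * α) (hγ : (d : ℝ) * b ≤ m * γ) :
    (((∑ i ∈ Finset.Icc (ℓ + 1) k, (d + 1 - i) : ℕ) * (b / m) : ℝ) : EReal) ≤
      secrecyCapacityOver F m (d + 1) k d ℓ α γ := by
  obtain ⟨sch, hrec, hsec⟩ := exists_reconstructs_secure F b hℓ hF
  have entropy : sch.fileEntropy / m =
      (∑ i ∈ Finset.Icc (ℓ + 1) k, (d + 1 - i) : ℕ) * ((b : ℝ) / m) := by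
    rw [sch.fileEntropy_eq, ← Finset.sum_mul, Nat.cast_mul, mul_div_assoc]
  rw [← entropy]
  exact le_iSup₂_of_le (d * b) b <| le_iSup₂_of_le _ sch <|
    le_iSup_of_le ⟨by rwa [Nat.cast_mul], hγ, hrec, hsec⟩ le_rfl

theorem secrecyCapacityOver_eq {b : ℕ} (hm : 0 < m) (hd : 0 < d) (hℓ : ℓ ≤ k) (hk : k ≤ d + 1)
    (hF : (d + 1).choose 2 ≤ Fintype.card F) (hΓ : (m : ℝ) * Γ = d * b) :
    secrecyCapacityOver F m (d + 1) k d ℓ Γ Γ = bandwidthLimitedBound d k ℓ Γ := by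
  refine (secrecyCapacityOver_le F hm hd d.lt_succ_self hk).antisymm ?_
  have link_eq : Γ / d = b / m := by
    rw [div_eq_div_iff (by positivity) (by positivity)]
    linarith
  rw [bandwidthLimitedBound_eq hk, link_eq]
  exact le_secrecyCapacityOver F hℓ hF hΓ.ge hΓ.ge

theorem bandwidthLimitedCapacityOver_eq {b : ℕ} (hm : 0 < m) (hd : 0 < d) (hℓ : ℓ ≤ k)
    (hk : k ≤ d + 1) (hF : (d + 1).choose 2 ≤ Fintype.card F) (hΓ₀ : 0 ≤ Γ)
    (hΓ : (m : ℝ) * Γ = d * b) :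
    bandwidthLimitedCapacityOver F m (d + 1) k d ℓ Γ = bandwidthLimitedBound d k ℓ Γ :=
  (bandwidthLimitedCapacityOver_le F hm hd d.lt_succ_self hk).antisymm <|
    (secrecyCapacityOver_eq F hm hd hℓ hk hF hΓ).ge.trans <|
      secrecyCapacityOver_le_bandwidthLimitedCapacityOver F hΓ₀

end Field

theorem secrecyCapacityOver_le_secrecyCapacity (F : Type) [Field F] [Fintype F] {m : ℕ}
    (hm : 0 < m) : secrecyCapacityOver F m n k d ℓ α γ ≤ secrecyCapacity n k d ℓ α γ :=
  le_iSup₂_of_le F inferInstance <| le_iSup_of_le inferInstance <| le_iSup₂_of_le m hm le_rfl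

theorem secrecyCapacity_le (hd₀ : 0 < d) (hd : d < n) (hk : k ≤ d + 1) :
    secrecyCapacity n k d ℓ α γ ≤ bandwidthLimitedBound d k ℓ γ :=
  iSup₂_le fun F _ => iSup_le fun _ => iSup₂_le fun _ hm => secrecyCapacityOver_le F hm hd₀ hd hk

theorem bandwidthLimitedCapacity_le (hd₀ : 0 < d) (hd : d < n) (hk : k ≤ d + 1) :
    bandwidthLimitedCapacity n k d ℓ Γ ≤ bandwidthLimitedBound d k ℓ Γ :=
  iSup₂_le fun _ hγ => iSup₂_le fun _ _ => (secrecyCapacity_le hd₀ hd hk).trans <|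
    EReal.coe_le_coe_iff.2 (bandwidthLimitedBound_mono hk hγ.2)

theorem secrecyCapacity_le_bandwidthLimitedCapacity (hΓ : 0 ≤ Γ) :
    secrecyCapacity n k d ℓ Γ Γ ≤ bandwidthLimitedCapacity n k d ℓ Γ :=
  le_iSup₂_of_le Γ ⟨hΓ, le_rfl⟩ <| le_iSup₂_of_le Γ hΓ le_rfl

-- With `m` symbols per data unit, `⌊m Γ / d⌋` symbols fit on a link, and
-- `⌊m Γ / d⌋ / m → Γ / d` as `m → ∞`.
theorem le_secrecyCapacity (hd₀ : 0 < d) (hℓ : ℓ ≤ k) (hk : k ≤ d + 1) (hΓ : 0 ≤ Γ) :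
    bandwidthLimitedBound d k ℓ Γ ≤ secrecyCapacity (d + 1) k d ℓ Γ Γ := by
  obtain ⟨p, hp, hprime⟩ := Nat.exists_infinite_primes ((d + 1).choose 2)
  have : Fact p.Prime := ⟨hprime⟩
  have link_nonneg : 0 ≤ Γ / d := by positivity
  have lim : Filter.Tendsto
      (fun m : ℕ => (∑ i ∈ Finset.Icc (ℓ + 1) k, (d + 1 - i) : ℕ) * (⌊Γ / d * m⌋₊ / m : ℝ))
      Filter.atTop (nhds (bandwidthLimitedBound d k ℓ Γ)) := by
    rw [bandwidthLimitedBound_eq hk]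
    exact ((tendsto_nat_floor_mul_div_atTop link_nonneg).comp
      tendsto_natCast_atTop_atTop).const_mul _
  refine le_of_tendsto ((continuous_coe_real_ereal.tendsto _).comp lim) ?_
  filter_upwards [Filter.eventually_gt_atTop 0] with m hm
  have bandwidth_le : (d : ℝ) * ⌊Γ / d * m⌋₊ ≤ m * Γ :=
    calc (d : ℝ) * ⌊Γ / d * m⌋₊ ≤ d * (Γ / d * m) := by
          gcongr
          exact Nat.floor_le (by positivity)
      _ = m * Γ := by field_simp
  exact (le_secrecyCapacityOver (ZMod p) hℓ (by rwa [ZMod.card]) bandwidth_le bandwidth_le).trans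
    (secrecyCapacityOver_le_secrecyCapacity (ZMod p) hm)

theorem secrecyCapacity_eq (hd : 0 < d) (hℓ : ℓ ≤ k) (hk : k ≤ d + 1) (hΓ : 0 ≤ Γ) :
    secrecyCapacity (d + 1) k d ℓ Γ Γ = bandwidthLimitedBound d k ℓ Γ :=
  (secrecyCapacity_le hd d.lt_succ_self hk).antisymm (le_secrecyCapacity hd hℓ hk hΓ)

theorem bandwidthLimitedCapacity_eq (hd : 0 < d) (hℓ : ℓ ≤ k) (hk : k ≤ d + 1) (hΓ : 0 ≤ Γ) :
    bandwidthLimitedCapacity (d + 1) k d ℓ Γ = bandwidthLimitedBound d k ℓ Γ :=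
  (bandwidthLimitedCapacity_le hd d.lt_succ_self hk).antisymm <|
    (le_secrecyCapacity hd hℓ hk hΓ).trans (secrecyCapacity_le_bandwidthLimitedCapacity hΓ)

end Capacity

/-- Bandwidth-limited secrecy capacity for `d = n - 1`, and its attainment with `α = Γ`; over a
field with at least `n (n - 1) / 2` elements it is attained by an actual scheme as soon as
`Γ / (n - 1)` data units are a whole number `b` of symbols (for example `m = 1`,
`Γ = (n - 1) b`). -/
theorem theorem2 (n k ℓ : ℕ) (hℓ : ℓ < k) (hk : k ≤ n - 1) (Γ : ℝ) (hΓ : 0 ≤ Γ) :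
    bandwidthLimitedCapacity n k (n - 1) ℓ Γ =
        ((∑ i ∈ Finset.Icc (ℓ + 1) k, ((n : ℝ) - i) * (Γ / ((n : ℝ) - 1)) : ℝ) : EReal) ∧
      secrecyCapacity n k (n - 1) ℓ Γ Γ =
        ((∑ i ∈ Finset.Icc (ℓ + 1) k, ((n : ℝ) - i) * (Γ / ((n : ℝ) - 1)) : ℝ) : EReal) ∧
      ∀ (F : Type) [Field F] [Fintype F] (m b : ℕ), 0 < m →
        (m : ℝ) * Γ = ((n : ℝ) - 1) * b → n * (n - 1) / 2 ≤ Fintype.card F →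
        bandwidthLimitedCapacityOver F m n k (n - 1) ℓ Γ =
            ((∑ i ∈ Finset.Icc (ℓ + 1) k, ((n : ℝ) - i) * (Γ / ((n : ℝ) - 1)) : ℝ) : EReal) ∧
          secrecyCapacityOver F m n k (n - 1) ℓ Γ Γ =
            ((∑ i ∈ Finset.Icc (ℓ + 1) k, ((n : ℝ) - i) * (Γ / ((n : ℝ) - 1)) : ℝ) : EReal) ∧
          ∃ sch : StorageScheme F n (n - 1) ((n - 1) * b) b
              (∑ i ∈ Finset.Icc (ℓ + 1) k, (n - i) * b),
            sch.Reconstructs k ∧ sch.Secure ℓ := by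
  obtain ⟨d, rfl⟩ := Nat.exists_eq_add_one_of_ne_zero (by omega : n ≠ 0)
  simp only [Nat.add_sub_cancel, Nat.cast_add_one, add_sub_cancel_right] at hk ⊢
  have hd : 0 < d := by omega
  have hk' : k ≤ d + 1 := hk.trans d.le_succ
  refine ⟨bandwidthLimitedCapacity_eq hd hℓ.le hk' hΓ, secrecyCapacity_eq hd hℓ.le hk' hΓ, ?_⟩
  intro F _ _ m b hm hb hF
  have hF' : (d + 1).choose 2 ≤ Fintype.card F := (Nat.choose_two_right _).trans_le hF
  exact ⟨bandwidthLimitedCapacityOver_eq F hm hd hℓ.le hk' hF' hΓ hb,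
    secrecyCapacityOver_eq F hm hd hℓ.le hk' hF' hb, exists_reconstructs_secure F b hℓ.le hF'⟩
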